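/- Let $n,k,s$ be positive integers with $n>s(s+2)k$, let $[n]=\{1,\dots,n\}$, and let $\binom{[n]}{k}$ denote the collection of all $k$-element subsets of $[n]$. Suppose that $\mathcal F\subset\binom{[n]}{k}$ satisfies $$|F_0\cup F_1\cup\dots\cup F_s|\le k+s(k-1)$$ for all (not necessarily distinct) $F_0,\dots,F_s\in\mathcal F$. Then $|\mathcal F|\le\binom{n-1}{k-1}$. -/

import Mathlib

/-- A family `F` of finite sets has property `U(s, q)` if `|F₁ ∪ ⋯ ∪ Fₛ| ≤ q` for every choice of
`s` members `F₁, …, Fₛ` of `F` (repetitions are allowed). -/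
def HasPropertyU (F : Finset (Finset ℕ)) (s q : ℕ) : Prop :=
  ∀ A : Fin s → Finset ℕ, (∀ i, A i ∈ F) → (Finset.univ.biUnion A).card ≤ q

/-! The star of all `k`-sets through one point meets the union condition with equality in the bound,
so the aim is to trade members avoiding `1` for sets missing from the star at `1`. An intersecting
family is covered by Erdős–Ko–Rado. Otherwise `k, s ≥ 2`, and compressions make the family shifted
without changing its size or losing the union condition.

Let `S` be the members avoiding `1` and `T` the `(k - 1)`-sets `G ⊆ [2, n]` with `G ∪ {1} ∉ F`. It
suffices that `|S| ≤ |T|`, which follows by counting disjoint pairs `(A, G)`. Put `t = s² + 2s - 1`.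

For `A ∈ S`, the link of `1` outside `A` has no `s` pairwise disjoint members: together with `A` and
`1` their union would be one too large. Averaging over permutations then puts at least a fraction
`(s² + s) / t` of the `(k - 1)`-sets off `A ∪ {1}` into `T` (`mul_choose_le_card_disjoint_missing`).

For `G ∈ T`, every `A ∈ S` violates a ballot condition, since otherwise `A` shifts down to `s + 1`
members with too large a union (`IsShifted.exists_card_inter_Icc`). A Pascal-type induction counts
the violating sets off `G`, and `mul_le_of_add_choose_le` shows that there are no more than the
first count requires. -/

/-! ### Counting the sets that violate a ballot condition -/

open Classical in
/-- The number of `(k + 1)`-subsets of `Y` that, for some `j`, have more than `j` members among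
`2, …, (s + 1) j + 1`. -/
theorem card_ballot_violating_add_le (s : ℕ) (Y : Finset ℕ) (hY : ∀ y ∈ Y, 2 ≤ y) (k : ℕ) :
    ((Y.powersetCard (k + 1)).filter
      (fun A => ∃ j, j + 1 ≤ (A ∩ Finset.Icc 2 ((s + 1) * j + 1)).card)).card
      + (Y.card + s).choose (k + 1) ≤ Y.card.choose (k + 1) + s * (Y.card + s).choose k := by
  -- Splitting on the largest element of `Y` gives a Pascal recursion for the violating sets, and
  -- every binomial term of the bound obeys the same recursion.
  induction Y using Finset.induction_on_max generalizing k with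
  | empty =>
    have h1 : ((∅ : Finset ℕ).powersetCard (k + 1)).filter
      (fun A => ∃ j, j + 1 ≤ (A ∩ Finset.Icc 2 ((s + 1) * j + 1)).card) = ∅ := by
      rw [Finset.powersetCard_eq_empty.2 (by simp)]; simp
    rw [h1]
    have := Nat.choose_succ_right_eq (0 + s) k
    simp only [Finset.card_empty, zero_add] at *
    have h2 : s.choose (k+1) * (k+1) ≤ s * s.choose k * (k + 1) := by
      rw [this]
      calc s.choose k * (s - k) ≤ s.choose k * (s * (k + 1)) := by
            gcongr
            nlinarith [Nat.sub_le s k, Nat.zero_le (s*k)]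
        _ = _ := by ring
    have := Nat.le_of_mul_le_mul_right h2 (Nat.succ_pos k)
    omega
  | insert y Y hmax ih =>
    have hyY : y ∉ Y := fun h => lt_irrefl _ (hmax y h)
    have ih := ih (fun z hz => hY z (Finset.mem_insert_of_mem hz))
    rw [Finset.card_insert_of_notMem hyY]
    set m := Y.card with hm
    -- Exactly in this range `(m+1+s choose k+1) ≤ s (m+1+s choose k)`, so the bound is at least the
    -- number of all `(k + 1)`-subsets.
    by_cases hsmall : m + 1 ≤ (s + 1) * k
    · have h1 : (((insert y Y).powersetCard (k + 1)).filter
          (fun A => ∃ j, j + 1 ≤ (A ∩ Finset.Icc 2 ((s + 1) * j + 1)).card)).card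
          ≤ (m + 1).choose (k + 1) := by
        refine (Finset.card_filter_le _ _).trans ?_
        rw [Finset.card_powersetCard, Finset.card_insert_of_notMem hyY]
      have h2 : (m + 1 + s).choose (k+1) * (k+1) ≤ s * (m + 1 + s).choose k * (k + 1) := by
        rw [Nat.choose_succ_right_eq]
        calc (m + 1 + s).choose k * (m + 1 + s - k) ≤ (m + 1 + s).choose k * (s * (k + 1)) := by
              gcongr
              rw [Nat.sub_le_iff_le_add]
              nlinarith
          _ = _ := by ring
      have := Nat.le_of_mul_le_mul_right h2 (Nat.succ_pos k)
      omega
    push Not at hsmall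
    rcases k with _ | k
    · have h1 : ((insert y Y).powersetCard (0 + 1)).filter
          (fun A => ∃ j, j + 1 ≤ (A ∩ Finset.Icc 2 ((s + 1) * j + 1)).card) = ∅ := by
        rw [Finset.filter_eq_empty_iff]
        rintro A hA ⟨j, hj⟩
        have h2 := Finset.card_le_card (Finset.inter_subset_left :
          A ∩ Finset.Icc 2 ((s + 1) * j + 1) ⊆ A)
        rw [(Finset.mem_powersetCard.1 hA).2] at h2
        obtain rfl : j = 0 := by omega
        simp at hj
      rw [h1]
      simp
    have hsub : ((insert y Y).powersetCard (k + 1 + 1)).filter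
          (fun A => ∃ j, j + 1 ≤ (A ∩ Finset.Icc 2 ((s + 1) * j + 1)).card) ⊆
        ((Y.powersetCard (k + 1 + 1)).filter
          (fun A => ∃ j, j + 1 ≤ (A ∩ Finset.Icc 2 ((s + 1) * j + 1)).card)) ∪
        ((Y.powersetCard (k + 1)).filter
          (fun A => ∃ j, j + 1 ≤ (A ∩ Finset.Icc 2 ((s + 1) * j + 1)).card)).image (insert y) := by
      intro A hA
      simp only [Finset.mem_filter, Finset.mem_powersetCard] at hA
      obtain ⟨⟨hAY, hAk⟩, j, hj⟩ := hA
      by_cases hyA : y ∈ A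
      · refine Finset.mem_union_right _ (Finset.mem_image.2
          ⟨A.erase y, ?_, Finset.insert_erase hyA⟩)
        simp only [Finset.mem_filter, Finset.mem_powersetCard]
        refine ⟨⟨?_, by rw [Finset.card_erase_of_mem hyA]; omega⟩, j, ?_⟩
        · rw [← Finset.subset_insert_iff]; exact hAY
        -- The maximum `y` is never needed for the violation: if the interval reached `y` it would
        -- contain the whole ground set, of size more than `(s + 1) (k + 1)`, forcing `j > k + 1`
        -- and `A` to have more than `k + 2` elements.
        · by_cases hyj : y ≤ (s + 1) * j + 1
          · exfalso
            have h1 : insert y Y ⊆ Finset.Icc 2 ((s + 1) * j + 1) := by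
              intro z hz
              refine Finset.mem_Icc.2 ⟨hY z hz, ?_⟩
              rcases Finset.mem_insert.1 hz with rfl | hz
              · exact hyj
              · exact (hmax z hz).le.trans hyj
            have h2 := Finset.card_le_card h1
            rw [Finset.card_insert_of_notMem hyY, Nat.card_Icc] at h2
            have h3 : (s + 1) * (k + 1) < (s + 1) * j := by omega
            have h4 := Nat.lt_of_mul_lt_mul_left h3
            have h5 := Finset.card_le_card (Finset.inter_subset_left :
              A ∩ Finset.Icc 2 ((s + 1) * j + 1) ⊆ A)
            omega
          · convert hj using 2
            ext z
            simp only [Finset.mem_inter, Finset.mem_erase, Finset.mem_Icc]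
            constructor
            · tauto
            · rintro ⟨h1, h2, h3⟩
              exact ⟨⟨by omega, h1⟩, h2, h3⟩
      · refine Finset.mem_union_left _ ?_
        simp only [Finset.mem_filter, Finset.mem_powersetCard]
        exact ⟨⟨(Finset.subset_insert_iff_of_notMem hyA).1 hAY, hAk⟩, j, hj⟩
    have h1 := (Finset.card_le_card hsub).trans (Finset.card_union_le _ _)
    have h2 := h1.trans (Nat.add_le_add_left Finset.card_image_le _)
    have i1 := ih (k + 1)
    have i2 := ih k
    have e1 : (m + 1 + s).choose (k + 1 + 1) = (m + s).choose (k + 1) + (m + s).choose (k + 1 + 1) := by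
      rw [show m + 1 + s = (m + s) + 1 by ring, Nat.choose_succ_succ]
    have e2 : (m + 1 + s).choose (k + 1) = (m + s).choose k + (m + s).choose (k + 1) := by
      rw [show m + 1 + s = (m + s) + 1 by ring, Nat.choose_succ_succ]
    have e3 : (m + 1).choose (k + 1 + 1) = m.choose (k + 1) + m.choose (k + 1 + 1) := by
      rw [Nat.choose_succ_succ]
    rw [e1, e2, e3, mul_add]
    omega

/-! ### Binomial estimates -/

/-- Each of the `s` successive ratios `(m+r+1 choose k) / (m+r choose k) = 1 + k / (m+r+1-k)` is at
least the last one, `r = s - 1`. -/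
theorem choose_mul_one_add_div_pow_le (m k s : ℕ) (hk : k < m) :
    (m.choose k : ℝ) * (1 + k / (m + s - k)) ^ s ≤ ((m + s).choose k : ℝ) := by
  have hkm : (k : ℝ) < m := by exact_mod_cast hk
  have key : ∀ r ≤ s, (m.choose k : ℝ) * (1 + k / (m + s - k)) ^ r ≤ ((m + r).choose k : ℝ) := by
    intro r hr
    induction r with
    | zero => simp
    | succ r ih =>
      have ih := ih (by omega)
      have hrs : (r : ℝ) + 1 ≤ s := by exact_mod_cast hr
      have hr0 : (0 : ℝ) ≤ r := by positivity
      have hpos : (0 : ℝ) < m + r + 1 - k := by linarith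
      have hpos' : (0 : ℝ) < m + s - k := by linarith
      have h1 : ((m + (r + 1)).choose k : ℝ) = ((m + r).choose k : ℝ) * (1 + k / (m + r + 1 - k)) := by
        have h := Nat.choose_mul_succ_eq (m + r) k
        have h2 : ((m + r).choose k : ℝ) * (m + r + 1) = ((m + (r + 1)).choose k : ℝ) * (m + r + 1 - k) := by
          have h3 : ((m + r + 1 - k : ℕ) : ℝ) = m + r + 1 - k := by
            rw [Nat.cast_sub (by omega)]; push_cast; ring
          rw [← h3]
          exact_mod_cast h
        field_simp
        linarith
      rw [h1, pow_succ, ← mul_assoc]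
      gcongr (?_) * (1 + ?_)
      exact div_le_div_of_nonneg_left (by positivity) hpos (by linarith)
  exact key s le_rfl

theorem one_add_mul_add_le_pow (x : ℝ) (hx : 0 ≤ x) (s : ℕ) :
    1 + s * x + s * (s - 1) / 2 * x ^ 2 ≤ (1 + x) ^ s := by
  induction s with
  | zero => simp
  | succ s ih =>
    have h : (0 : ℝ) ≤ s * (s - 1) / 2 := by
      rcases s with _ | s
      · simp
      · push_cast
        rw [add_sub_cancel_right]
        positivity
    have h1 := mul_le_mul_of_nonneg_right ih (by linarith : (0 : ℝ) ≤ 1 + x)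
    have h2 := mul_nonneg h (pow_nonneg hx 3)
    rw [pow_succ]
    refine le_trans ?_ h1
    push_cast
    linear_combination h2

/-- There is slack: `(s² + 2s - 1) x`, `1 + x` and the correction from the quadratic term each cost
a factor at most `7/6`, and `(7/6)³ < 2`. -/
theorem ballot_numeric_bound (s x : ℝ) (hs : 2 ≤ s) (hx : 0 ≤ x)
    (hxs : x * (s ^ 2 + 2 * s - 2) ≤ 1) :
    (s ^ 2 + 2 * s - 1) * (1 + x) * (s * (s + 1) / 2 * x + s ^ 2 * (s - 1) / 2 * x ^ 2)
      ≤ s ^ 2 + s := by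
  have ht : 6 ≤ s ^ 2 + 2 * s - 2 := by nlinarith
  have hx6 : x ≤ 1 / 6 := by linarith [mul_le_mul_of_nonneg_left ht hx]
  have h1 : (s ^ 2 + 2 * s - 1) * x ≤ 7 / 6 := by linarith
  have hs1 : 0 ≤ s - 1 := by linarith
  have hs0 : 0 ≤ s := by linarith
  have h2 : s * (s - 1) * x ≤ (s + 1) / 6 := by
    have h3 : s * (s - 1) * 6 ≤ (s + 1) * (s ^ 2 + 2 * s - 2) := by
      -- Four times the difference of the two sides is `(s - 2)(2s - 1)² + 15s - 6`.
      nlinarith [mul_nonneg (by linarith : 0 ≤ s - 2) (sq_nonneg (2 * s - 1))]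
    have h4 := mul_le_mul_of_nonneg_right h3 hx
    have h5 := mul_le_mul_of_nonneg_left hxs (by linarith : 0 ≤ s + 1)
    linarith
  have h3 : s * (s + 1) / 2 + s ^ 2 * (s - 1) / 2 * x ≤ s * (s + 1) / 2 * (7 / 6) := by
    linarith [mul_le_mul_of_nonneg_left h2 (by linarith : 0 ≤ s / 2)]
  have h4 : 0 ≤ s * (s + 1) / 2 + s ^ 2 * (s - 1) / 2 * x := by positivity
  have h5 : 0 ≤ (s ^ 2 + 2 * s - 1) * x := mul_nonneg (by linarith) hx
  calc (s ^ 2 + 2 * s - 1) * (1 + x) * (s * (s + 1) / 2 * x + s ^ 2 * (s - 1) / 2 * x ^ 2)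
      = ((s ^ 2 + 2 * s - 1) * x) * (1 + x) *
        (s * (s + 1) / 2 + s ^ 2 * (s - 1) / 2 * x) := by ring
    _ ≤ (7 / 6) * (1 + 1 / 6) * (s * (s + 1) / 2 * (7 / 6)) := by gcongr
    _ ≤ s ^ 2 + s := by nlinarith

/-- With `x = k / (m + s - k)`, `C = (m choose k)` and `D = (m+s choose k)`, the hypothesis gives `X
≤ C - D (1 - s x)`, while `D ≥ C (1 + x)^s`. The terms linear in `x` cancel, leaving `X` of order `C
x²`; one factor `x` turns `C` into roughly `(m-1 choose k-1)`, the other absorbs `s² + 2s - 1`. -/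
theorem mul_le_of_add_choose_le (s k m X : ℕ) (hs : 2 ≤ s) (hk : 1 ≤ k)
    (hm : (s ^ 2 + 2 * s - 1) * k ≤ m)
    (hX : X + (m + s).choose k ≤ m.choose k + s * (m + s).choose (k - 1)) :
    (s ^ 2 + 2 * s - 1) * X ≤ (s ^ 2 + s) * (m - 1).choose (k - 1) := by
  have hs' : (2 : ℝ) ≤ s := by exact_mod_cast hs
  have hk' : (1 : ℝ) ≤ k := by exact_mod_cast hk
  have hm' : ((s : ℝ) ^ 2 + 2 * s - 1) * k ≤ m := by
    have : ((s ^ 2 + 2 * s - 1 : ℕ) : ℝ) = (s : ℝ) ^ 2 + 2 * s - 1 := by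
      rw [Nat.cast_sub (by nlinarith)]; push_cast; ring
    rw [← this]; exact_mod_cast hm
  have hkm : (k : ℝ) < m := by nlinarith
  have hkm' : k < m := by exact_mod_cast hkm
  have hX' : (X : ℝ) + ((m + s).choose k : ℝ) ≤ m.choose k + s * ((m + s).choose (k - 1) : ℝ) := by
    exact_mod_cast hX
  obtain ⟨l, rfl⟩ : ∃ l, k = l + 1 := ⟨k - 1, by omega⟩
  obtain ⟨N, rfl⟩ : ∃ N, m = N + 1 := ⟨m - 1, by omega⟩
  simp only [Nat.add_sub_cancel] at *
  have hpow := choose_mul_one_add_div_pow_le (N + 1) (l + 1) s hkm'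
  obtain ⟨K, hK⟩ : ∃ K : ℝ, K = ((l + 1 : ℕ) : ℝ) := ⟨_, rfl⟩
  obtain ⟨M, hM⟩ : ∃ M : ℝ, M = ((N + 1 : ℕ) : ℝ) := ⟨_, rfl⟩
  rw [← hK] at hk' hm' hkm hpow
  rw [← hM] at hm' hkm hpow
  have hd : 0 < M + s - K := by linarith
  obtain ⟨x, hx⟩ : ∃ x : ℝ, x = K / (M + s - K) := ⟨_, rfl⟩
  rw [← hx] at hpow
  have hx0 : 0 < x := by rw [hx]; exact div_pos (by linarith) hd
  -- the choose below is at most `x` times the choose above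
  have hb : ((N + 1 + s).choose l : ℝ) ≤ x * ((N + 1 + s).choose (l + 1) : ℝ) := by
    have h := Nat.choose_succ_right_eq (N + 1 + s) l
    have h2 : ((N + 1 + s).choose (l + 1) : ℝ) * K
        = ((N + 1 + s).choose l : ℝ) * (M + s - l) := by
      have h3 : ((N + 1 + s - l : ℕ) : ℝ) = M + s - l := by
        rw [Nat.cast_sub (by omega), hM]; push_cast; ring
      rw [← h3, hK]; exact_mod_cast h
    rw [hx, div_mul_eq_mul_div, le_div_iff₀ hd]
    have h4 : (0 : ℝ) ≤ ((N + 1 + s).choose l : ℝ) := by positivity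
    have h5 : K = l + 1 := by rw [hK]; push_cast; ring
    nlinarith
  have hc : ((N + 1).choose (l + 1) : ℝ) * K = M * (N.choose l : ℝ) := by
    have := Nat.add_one_mul_choose_eq N l
    rw [hK, hM]; exact_mod_cast this.symm
  have hpow2 := one_add_mul_add_le_pow x hx0.le s
  have hC0 : (0 : ℝ) ≤ ((N + 1).choose (l + 1) : ℝ) := by positivity
  generalize ((N + 1).choose (l + 1) : ℝ) = C at *
  generalize ((N + 1 + s).choose (l + 1) : ℝ) = D at *
  -- `x` is at most `1 / (s² + 2 s - 2)`
  have hxq : x * ((s : ℝ) ^ 2 + 2 * s - 2) ≤ 1 := by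
    rw [hx, div_mul_eq_mul_div, div_le_one hd]
    nlinarith
  have hsx : s * x ≤ 1 := by nlinarith
  have hXle : (X : ℝ) ≤ C * (s * (s + 1) / 2 * x ^ 2 + s ^ 2 * (s - 1) / 2 * x ^ 3) := by
    have h1 : C * (1 + s * x + s * (s - 1) / 2 * x ^ 2) ≤ D :=
      (mul_le_mul_of_nonneg_left hpow2 hC0).trans hpow
    -- Multiplying out `(1 + s x + s(s-1)/2 x²)(1 - s x)` gives `1 - s(s+1)/2 x² - s²(s-1)/2 x³`.
    have h2 := mul_le_mul_of_nonneg_right h1 (by linarith : (0 : ℝ) ≤ 1 - s * x)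
    have h3 := mul_le_mul_of_nonneg_left hb (by positivity : (0 : ℝ) ≤ s)
    nlinarith
  have hKM : C * x ≤ (N.choose l : ℝ) * (1 + x) := by
    have h1 : x * (M + s - K) = K := by rw [hx]; field_simp
    have h2 : x * M ≤ (1 + x) * K := by nlinarith
    have h3 : 0 < M := by linarith
    have h4 : (0 : ℝ) ≤ (N.choose l : ℝ) := by positivity
    have h5 : 0 < K := by linarith
    refine le_of_mul_le_mul_right ?_ h5
    calc C * x * K = x * M * (N.choose l : ℝ) := by rw [mul_right_comm, hc]; ring
      _ ≤ (1 + x) * K * (N.choose l : ℝ) := by gcongr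
      _ = _ := by ring
  have hN0 : (0 : ℝ) ≤ (N.choose l : ℝ) := by positivity
  have hnum := ballot_numeric_bound (s : ℝ) x hs' hx0.le hxq
  have hfinal : ((s : ℝ) ^ 2 + 2 * s - 1) * X ≤ (s ^ 2 + s) * (N.choose l : ℝ) := by
    have ht : (0 : ℝ) ≤ (s : ℝ) ^ 2 + 2 * s - 1 := by nlinarith
    have h4 : (0 : ℝ) ≤ s * (s + 1) / 2 * x + s ^ 2 * (s - 1) / 2 * x ^ 2 := by
      have : (0 : ℝ) ≤ s - 1 := by linarith
      positivity
    calc ((s : ℝ) ^ 2 + 2 * s - 1) * X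
        ≤ ((s : ℝ) ^ 2 + 2 * s - 1) *
          (C * (s * (s + 1) / 2 * x ^ 2 + s ^ 2 * (s - 1) / 2 * x ^ 3)) := by gcongr
      _ = ((s : ℝ) ^ 2 + 2 * s - 1) * ((C * x) *
          (s * (s + 1) / 2 * x + s ^ 2 * (s - 1) / 2 * x ^ 2)) := by ring
      _ ≤ ((s : ℝ) ^ 2 + 2 * s - 1) * (((N.choose l : ℝ) * (1 + x)) *
          (s * (s + 1) / 2 * x + s ^ 2 * (s - 1) / 2 * x ^ 2)) := by gcongr
      _ = (((s : ℝ) ^ 2 + 2 * s - 1) * (1 + x) *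
          (s * (s + 1) / 2 * x + s ^ 2 * (s - 1) / 2 * x ^ 2)) * (N.choose l : ℝ) := by ring
      _ ≤ _ := by gcongr
  have : ((s ^ 2 + 2 * s - 1 : ℕ) : ℝ) = (s : ℝ) ^ 2 + 2 * s - 1 := by
    rw [Nat.cast_sub (by nlinarith)]; push_cast; ring
  rw [← this] at hfinal
  exact_mod_cast hfinal

/-! ### Families without large matchings, by averaging over permutations -/

/-- Over all permutations, each `r`-subset of `α` is equally often the image of a fixed one. -/
theorem card_filter_perm_map_mem_mul_choose {α : Type*} [Fintype α] [DecidableEq α] (r : ℕ)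
    (B : Finset (Finset α)) (hB : ∀ b ∈ B, b.card = r) (P : Finset α) (hP : P.card = r) :
    ((Finset.univ : Finset (Equiv.Perm α)).filter (fun σ => P.map σ.toEmbedding ∈ B)).card
      * (Fintype.card α).choose r = B.card * Fintype.card (Equiv.Perm α) := by
  have hconst : ∀ Q : Finset α, Q.card = r →
      ((Finset.univ : Finset (Equiv.Perm α)).filter (fun σ => P.map σ.toEmbedding = Q)).card
      = ((Finset.univ : Finset (Equiv.Perm α)).filter (fun σ => P.map σ.toEmbedding = P)).card := by
    intro Q hQ
    obtain ⟨τ, hτ⟩ : ∃ τ : Equiv.Perm α, P.map τ.toEmbedding = Q := by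
      obtain ⟨e⟩ : Nonempty ({x // x ∈ P} ≃ {x // x ∈ Q}) :=
        ⟨Fintype.equivOfCardEq (by simp [hP, hQ])⟩
      refine ⟨e.extendSubtype, Finset.eq_of_subset_of_card_le ?_ (by simp [hP, hQ])⟩
      intro y hy
      obtain ⟨x, hx, rfl⟩ := Finset.mem_map.1 hy
      exact e.extendSubtype_mem x hx
    symm
    refine Finset.card_bij (fun σ _ => τ * σ) ?_ ?_ ?_
    · intro σ hσ
      simp only [Finset.mem_filter, Finset.mem_univ, true_and] at hσ ⊢
      rw [← hτ]
      conv_rhs => rw [← hσ]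
      rw [Finset.map_map]
      rfl
    · intro a _ b _ h
      exact mul_left_cancel h
    · intro σ hσ
      simp only [Finset.mem_filter, Finset.mem_univ, true_and] at hσ
      refine ⟨τ⁻¹ * σ, ?_, by simp⟩
      simp only [Finset.mem_filter, Finset.mem_univ, true_and]
      have h : (P.map σ.toEmbedding).map (τ⁻¹ : Equiv.Perm α).toEmbedding = P := by
        rw [hσ, ← hτ, Finset.map_map]
        ext x
        simp
      rw [Finset.map_map] at h
      exact h
  have hfib : ∀ C : Finset (Finset α), (∀ c ∈ C, c.card = r) →
      ((Finset.univ : Finset (Equiv.Perm α)).filter (fun σ => P.map σ.toEmbedding ∈ C)).card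
      = C.card *
        ((Finset.univ : Finset (Equiv.Perm α)).filter (fun σ => P.map σ.toEmbedding = P)).card := by
    intro C hC
    rw [Finset.card_eq_sum_card_fiberwise
      (s := Finset.univ.filter (fun σ : Equiv.Perm α => P.map σ.toEmbedding ∈ C))
      (f := fun σ : Equiv.Perm α => P.map σ.toEmbedding) (t := C)
      (fun σ hσ => (Finset.mem_filter.1 hσ).2), ← smul_eq_mul]
    refine Finset.sum_eq_card_nsmul ?_
    intro Q hQ
    rw [← hconst Q (hC Q hQ), Finset.filter_filter]
    congr 1
    ext σ
    simp only [Finset.mem_filter, Finset.mem_univ, true_and]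
    exact ⟨fun h => h.2, fun h => ⟨h ▸ hQ, h⟩⟩
  -- Taking all `r`-sets as the family evaluates the common fibre size, which is then eliminated.
  have hall := hfib (Finset.univ.powersetCard r) (fun c hc => (Finset.mem_powersetCard.1 hc).2)
  rw [Finset.filter_true_of_mem, Finset.card_powersetCard, Finset.card_univ, Finset.card_univ] at hall
  · rw [hall, hfib B hB]; ring
  · intro σ _
    simp [Finset.mem_powersetCard, hP]

/-- An `r`-uniform family without `s` pairwise disjoint members, on a ground set which has room
for `t` disjoint `r`-sets, has density at most `(s - 1) / t`. -/
theorem mul_card_le_of_no_matching {α : Type*} [Fintype α] [DecidableEq α] (r s t : ℕ)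
    (B : Finset (Finset α)) (hB : ∀ b ∈ B, b.card = r) (ht : t * r ≤ Fintype.card α)
    (hno : ∀ g : Fin s → Finset α, (∀ i, g i ∈ B) → ¬ Pairwise (fun i j => Disjoint (g i) (g j))) :
    t * B.card ≤ (s - 1) * (Fintype.card α).choose r := by
  obtain ⟨P, hPr, hPd⟩ : ∃ P : Fin t → Finset α, (∀ i, (P i).card = r) ∧
      Pairwise (fun i j => Disjoint (P i) (P j)) := by
    obtain ⟨e⟩ : Nonempty ((Fin t × Fin r) ↪ α) :=
      Function.Embedding.nonempty_of_card_le (by simpa using ht)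
    refine ⟨fun i => Finset.univ.map ⟨fun j => e (i, j), fun a b h => by simpa using h⟩,
      by simp, ?_⟩
    intro i j hij
    rw [Finset.disjoint_left]
    rintro x hx hy
    simp only [Finset.mem_map, Finset.mem_univ, true_and] at hx hy
    obtain ⟨a, rfl⟩ := hx
    obtain ⟨b, hb⟩ := hy
    exact hij (Prod.ext_iff.1 (e.injective hb)).1.symm
  -- The images of the `P i` stay pairwise disjoint, so `s` of them in `B` would be a forbidden
  -- matching.
  have hσ : ∀ σ : Equiv.Perm α,
      ((Finset.univ : Finset (Fin t)).filter (fun i => (P i).map σ.toEmbedding ∈ B)).card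
        ≤ s - 1 := by
    intro σ
    by_contra! hlt
    have hle : s ≤ ((Finset.univ : Finset (Fin t)).filter
      (fun i => (P i).map σ.toEmbedding ∈ B)).card := by omega
    obtain ⟨e⟩ : Nonempty (Fin s ↪ ((Finset.univ : Finset (Fin t)).filter
      (fun i => (P i).map σ.toEmbedding ∈ B))) :=
      Function.Embedding.nonempty_of_card_le (by rwa [Fintype.card_fin, Fintype.card_coe])
    refine hno (fun i => (P (e i)).map σ.toEmbedding)
      (fun i => (Finset.mem_filter.1 (e i).2).2) ?_
    intro i j hij
    rw [Finset.disjoint_map]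
    exact hPd (fun h => hij (e.injective (Subtype.ext h)))
  have hcount : ∑ σ : Equiv.Perm α,
      ((Finset.univ : Finset (Fin t)).filter (fun i => (P i).map σ.toEmbedding ∈ B)).card
      = ∑ i : Fin t, ((Finset.univ : Finset (Equiv.Perm α)).filter
        (fun σ => (P i).map σ.toEmbedding ∈ B)).card := by
    simp only [Finset.card_filter]
    exact Finset.sum_comm
  have hle : ∑ i : Fin t, ((Finset.univ : Finset (Equiv.Perm α)).filter
        (fun σ => (P i).map σ.toEmbedding ∈ B)).card
      ≤ Fintype.card (Equiv.Perm α) * (s - 1) := by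
    rw [← hcount]
    refine (Finset.sum_le_card_nsmul _ _ _ (fun σ _ => hσ σ)).trans ?_
    simp [Finset.card_univ]
  refine Nat.le_of_mul_le_mul_right ?_ (Fintype.card_pos (α := Equiv.Perm α))
  calc t * B.card * Fintype.card (Equiv.Perm α)
      = ∑ i : Fin t, ((Finset.univ : Finset (Equiv.Perm α)).filter
        (fun σ => (P i).map σ.toEmbedding ∈ B)).card * (Fintype.card α).choose r := by
        simp only [card_filter_perm_map_mem_mul_choose r B hB _ (hPr _)]
        simp [mul_assoc]
    _ ≤ Fintype.card (Equiv.Perm α) * (s - 1) * (Fintype.card α).choose r := by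
        rw [← Finset.sum_mul]
        gcongr
    _ = _ := by ring

/-- The same density bound for families of subsets of a finite set. -/
theorem mul_card_le_of_no_matching_on {α : Type*} [DecidableEq α] (X : Finset α) (r s t : ℕ)
    (B : Finset (Finset α)) (hB : B ⊆ X.powersetCard r) (ht : t * r ≤ X.card)
    (hno : ∀ g : Fin s → Finset α, (∀ i, g i ∈ B) → ¬ Pairwise (fun i j => Disjoint (g i) (g j))) :
    t * B.card ≤ (s - 1) * X.card.choose r := by
  have hmap : ∀ b ∈ B, (b.subtype (· ∈ X)).map (Function.Embedding.subtype (· ∈ X)) = b := by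
    intro b hb
    exact Finset.subtype_map_of_mem fun x hx => (Finset.mem_powersetCard.1 (hB hb)).1 hx
  have hcard : (B.image (fun b => b.subtype (· ∈ X))).card = B.card := by
    refine Finset.card_image_of_injOn ?_
    intro a ha b hb h
    have h' : a.subtype (· ∈ X) = b.subtype (· ∈ X) := h
    rw [← hmap a ha, ← hmap b hb, h']
  rw [← hcard, ← Fintype.card_coe X]
  refine mul_card_le_of_no_matching (α := X) r s t _ ?_ (by simpa using ht) ?_
  · intro c hc
    obtain ⟨b, hb, rfl⟩ := Finset.mem_image.1 hc
    rw [← (Finset.mem_powersetCard.1 (hB hb)).2]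
    conv_rhs => rw [← hmap b hb]
    simp
  · intro g hg hd
    refine hno (fun i => (g i).map (Function.Embedding.subtype (· ∈ X))) ?_ ?_
    · intro i
      obtain ⟨b, hb, h⟩ := Finset.mem_image.1 (hg i)
      rw [← h, hmap b hb]
      exact hb
    · intro i j hij
      rw [Finset.disjoint_map]
      exact hd hij

/-! ### Compression and shifted families -/

/-- Replacing `j` by `i` in the members of a family, where possible, preserves `HasPropertyU`. -/
theorem HasPropertyU.compression {F : Finset (Finset ℕ)} {s q : ℕ} (hU : HasPropertyU F s q)
    {i j : ℕ} (hij : i ≠ j) : HasPropertyU (UV.compression {i} {j} F) s q := by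
  intro A hA
  have hmoved : ∀ l, A l ∉ F → i ∈ A l ∧ j ∉ A l ∧ (A l ∪ {j}) \ {i} ∈ F := by
    intro l hl
    refine ⟨?_, ?_, ?_⟩
    · simpa using UV.le_of_mem_compression_of_notMem (hA l) hl
    · simpa using UV.disjoint_of_mem_compression_of_notMem (hA l) hl
    · simpa using UV.sup_sdiff_mem_of_mem_compression_of_notMem (hA l) hl
  have hstay : ∀ l, j ∈ A l → A l ∈ F ∧ UV.compress {i} {j} (A l) ∈ F := by
    intro l hl
    rcases UV.mem_compression.1 (hA l) with h | ⟨h, -⟩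
    · exact h
    · exact absurd hl (hmoved l h).2.1
  by_cases hall : ∀ l, A l ∈ F
  · exact hU A hall
  push Not at hall
  obtain ⟨l₀, hl₀⟩ := hall
  by_cases hj : ∃ r, j ∈ A r
  · obtain ⟨r, hr⟩ := hj
    -- `A r` contains `j`, so it was not moved and its compression is also in `F`. Using that
    -- compression supplies `i`, and the original of the moved set `A l₀` supplies `j`; nothing is
    -- lost from the union.
    let B : Fin s → Finset ℕ := fun l =>
      if l = r then UV.compress {i} {j} (A r)
      else if A l ∈ F then A l else (A l ∪ {j}) \ {i}
    have hB : ∀ l, B l ∈ F := by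
      intro l
      simp only [B]
      split_ifs with h1 h2
      · exact (hstay r hr).2
      · exact h2
      · exact (hmoved l h2).2.2
    refine (Finset.card_le_card ?_).trans (hU B hB)
    have hrB : A r \ {j} ⊆ B r ∧ i ∈ B r := by
      simp only [B, if_true, UV.compress]
      split_ifs with h
      · constructor
        · intro x hx; simp at hx ⊢; tauto
        · simp [hij]
      · simp only [Finset.disjoint_singleton_left,
          Finset.singleton_subset_iff, hr, and_true, not_not] at h
        exact ⟨Finset.sdiff_subset, h⟩
    have hlr : l₀ ≠ r := by
      rintro rfl
      exact hl₀ (hstay _ hr).1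
    have hjB : j ∈ B l₀ := by
      simp [B, hlr, hl₀, hij.symm]
    intro x hx
    obtain ⟨l, -, hxl⟩ := Finset.mem_biUnion.1 hx
    rw [Finset.mem_biUnion]
    by_cases hxi : x = i
    · exact ⟨r, Finset.mem_univ _, hxi ▸ hrB.2⟩
    by_cases hxj : x = j
    · exact ⟨l₀, Finset.mem_univ _, hxj ▸ hjB⟩
    refine ⟨l, Finset.mem_univ _, ?_⟩
    by_cases hl : l = r
    · subst hl
      exact hrB.1 (by simp [hxl, hxj])
    · simp only [B, if_neg hl]
      split_ifs
      · exact hxl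
      · simp [hxl, hxi]
  · push Not at hj
    -- The union of the `A l` contains `i` but not `j`; undoing the moves trades `i` for `j`, so the
    -- size does not drop.
    let B : Fin s → Finset ℕ := fun l => if A l ∈ F then A l else (A l ∪ {j}) \ {i}
    have hB : ∀ l, B l ∈ F := by
      intro l
      simp only [B]
      split_ifs with h
      · exact h
      · exact (hmoved l h).2.2
    have hjB : j ∈ B l₀ := by
      simp [B, hl₀, hij.symm]
    have hjU : j ∉ (Finset.univ.biUnion A).erase i := by
      simp [hj]
    have hiU : i ∈ Finset.univ.biUnion A :=
      Finset.mem_biUnion.2 ⟨l₀, Finset.mem_univ _, (hmoved l₀ hl₀).1⟩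
    have hsub : insert j ((Finset.univ.biUnion A).erase i) ⊆ Finset.univ.biUnion B := by
      intro x hx
      rw [Finset.mem_biUnion]
      rcases Finset.mem_insert.1 hx with rfl | hx
      · exact ⟨l₀, Finset.mem_univ _, hjB⟩
      · obtain ⟨hxi, hx⟩ := Finset.mem_erase.1 hx
        obtain ⟨l, -, hxl⟩ := Finset.mem_biUnion.1 hx
        refine ⟨l, Finset.mem_univ _, ?_⟩
        simp only [B]
        split_ifs
        · exact hxl
        · simp [hxl, hxi]
    have h1 := (Finset.card_le_card hsub).trans (hU B hB)
    rw [Finset.card_insert_of_notMem hjU, Finset.card_erase_of_mem hiU] at h1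
    have h2 := Finset.card_pos.2 ⟨i, hiU⟩
    omega

/-- A family is shifted if replacing an element of a member by a smaller positive one never
leaves the family. -/
def IsShifted (F : Finset (Finset ℕ)) : Prop :=
  ∀ A ∈ F, ∀ i j, 1 ≤ i → i < j → j ∈ A → i ∉ A → insert i (A.erase j) ∈ F

theorem sum_compress_le {i j : ℕ} (hij : i < j) (A : Finset ℕ) :
    ∑ x ∈ UV.compress {i} {j} A, x ≤ ∑ x ∈ A, x ∧
      (UV.compress {i} {j} A ≠ A → ∑ x ∈ UV.compress {i} {j} A, x < ∑ x ∈ A, x) := by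
  by_cases h : Disjoint {i} A ∧ {j} ≤ A
  · have hlt : ∑ x ∈ UV.compress {i} {j} A, x < ∑ x ∈ A, x := by
      rw [UV.compress_of_disjoint_of_le h.1 h.2]
      have hi : i ∉ A := by simpa using h.1
      have hj : j ∈ A := by simpa using h.2
      have : (A ⊔ {i}) \ {j} = insert i (A.erase j) := by
        ext x
        simp only [Finset.sup_eq_union, Finset.mem_sdiff, Finset.mem_union, Finset.mem_singleton,
          Finset.mem_insert, Finset.mem_erase]
        by_cases hx : x = i
        · simp [hx, hij.ne]
        · tauto
      rw [this, Finset.sum_insert (by simp [hi]), ← Finset.add_sum_erase A _ hj]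
      omega
    exact ⟨hlt.le, fun _ => hlt⟩
  · have : UV.compress {i} {j} A = A := if_neg h
    rw [this]
    exact ⟨le_rfl, fun h => absurd rfl h⟩

/-- The sum of all elements of all members is the potential that makes repeated shifting terminate.
-/
theorem sum_compression_lt {i j : ℕ} (hij : i < j) (F : Finset (Finset ℕ)) {A : Finset ℕ}
    (hA : A ∈ F) (hA' : UV.compress {i} {j} A ∉ F) :
    ∑ B ∈ UV.compression {i} {j} F, ∑ x ∈ B, x < ∑ B ∈ F, ∑ x ∈ B, x := by
  rw [UV.compression, Finset.sum_union UV.compress_disjoint]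
  rw [← Finset.sum_filter_add_sum_filter_not F (fun B => UV.compress {i} {j} B ∈ F)]
  refine Nat.add_lt_add_left ?_ _
  rw [Finset.filter_image, Finset.sum_image]
  · refine Finset.sum_lt_sum (fun B _ => (sum_compress_le hij B).1) ⟨A, ?_, ?_⟩
    · simp [hA, hA']
    · exact (sum_compress_le hij A).2 (fun h => hA' (by rw [h]; exact hA))
  · exact UV.compress_injOn

/-- Every family with `HasPropertyU` may be replaced by a shifted one of the same size. -/
theorem exists_isShifted {n k s q : ℕ} {F : Finset (Finset ℕ)}
    (hF : F ⊆ (Finset.Icc 1 n).powersetCard k) (hU : HasPropertyU F s q) :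
    ∃ G : Finset (Finset ℕ), G ⊆ (Finset.Icc 1 n).powersetCard k ∧ HasPropertyU G s q ∧
      G.card = F.card ∧ IsShifted G := by
  induction hN : ∑ B ∈ F, ∑ x ∈ B, x using Nat.strong_induction_on generalizing F with
  | _ N ih =>
  by_cases hsh : IsShifted F
  · exact ⟨F, hF, hU, rfl, hsh⟩
  simp only [IsShifted, not_forall] at hsh
  obtain ⟨A, hA, i, j, hi, hij, hjA, hiA, hnot⟩ := hsh
  have hcomp : UV.compress {i} {j} A = insert i (A.erase j) := by
    rw [UV.compress_of_disjoint_of_le (by simpa using hiA) (by simpa using hjA)]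
    ext x
    simp only [Finset.sup_eq_union, Finset.mem_sdiff, Finset.mem_union, Finset.mem_singleton,
      Finset.mem_insert, Finset.mem_erase]
    by_cases hx : x = i
    · simp [hx, hij.ne]
    · tauto
  have hlt := sum_compression_lt hij F hA (by rwa [hcomp])
  obtain ⟨G, h1, h2, h3, h4⟩ := ih _ (hN ▸ hlt) (F := UV.compression {i} {j} F) (by
    intro B hB
    rcases UV.mem_compression.1 hB with ⟨h, -⟩ | ⟨-, C, hC, rfl⟩
    · exact hF h
    · obtain ⟨hC1, hC2⟩ := Finset.mem_powersetCard.1 (hF hC)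
      refine Finset.mem_powersetCard.2 ⟨?_, by rw [UV.card_compress (by simp), hC2]⟩
      unfold UV.compress
      split_ifs with h
      · intro x hx
        simp only [Finset.sup_eq_union, Finset.mem_sdiff, Finset.mem_union,
          Finset.mem_singleton] at hx
        rcases hx.1 with hx | rfl
        · exact hC1 hx
        · have := Finset.mem_Icc.1 (hC1 (by simpa using h.2 : j ∈ C))
          exact Finset.mem_Icc.2 ⟨hi, by omega⟩
      · exact hC1) (hU.compression hij.ne) rfl
  exact ⟨G, h1, h2, h3.trans (UV.card_compression _ _ _), h4⟩

/-- A shifted family contains every set of positive numbers lying below one of its members. -/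
theorem IsShifted.image_mem {F : Finset (Finset ℕ)} (hF : IsShifted F) {k : ℕ} {f g : Fin k → ℕ}
    (hf : StrictMono f) (hg : StrictMono g) (hgf : ∀ i, g i ≤ f i) (hg1 : ∀ i, 1 ≤ g i)
    (hmem : Finset.univ.image f ∈ F) : Finset.univ.image g ∈ F := by
  -- Coordinates are lowered from the smallest upwards, so that each hybrid of `g` and `f` stays
  -- strictly increasing and each change is a single shift.
  have key : ∀ t ≤ k, Finset.univ.image (fun i : Fin k => if i.1 < t then g i else f i) ∈ F := by
    intro t ht
    induction t with
    | zero => simpa using hmem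
    | succ t ih =>
      have ih := ih (by omega)
      let a : Fin k := ⟨t, by omega⟩
      have hrest : ∀ i : Fin k, i ≠ a →
          (if i.1 < t + 1 then g i else f i) = if i.1 < t then g i else f i := by
        intro i hi
        have : i.1 ≠ t := fun h => hi (Fin.ext h)
        by_cases h : i.1 < t
        · rw [if_pos h, if_pos (by omega)]
        · rw [if_neg h, if_neg (by omega)]
      rcases (hgf a).eq_or_lt with heq | hlt
      · convert ih using 2
        funext i
        by_cases hi : i = a
        · subst hi; simpa [a] using heq
        · exact hrest i hi
      have hlow : ∀ i : Fin k, i.1 < t → g i < g a := fun i hi => hg (Fin.lt_def.2 hi)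
      have hhigh : ∀ i : Fin k, t < i.1 → f a < f i := fun i hi => hf (Fin.lt_def.2 hi)
      convert hF _ ih (g a) (f a) (hg1 a) hlt ?_ ?_ using 1
      · ext x
        simp only [Finset.mem_image, Finset.mem_univ, true_and, Finset.mem_insert,
          Finset.mem_erase]
        constructor
        · rintro ⟨i, rfl⟩
          by_cases hi : i = a
          · left; subst hi; simp [a]
          · right
            rw [hrest i hi]
            refine ⟨?_, i, rfl⟩
            have : i.1 ≠ t := fun h => hi (Fin.ext h)
            split_ifs with h
            · have := hlow i h; omega
            · have := hhigh i (by omega); omega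
        · rintro (rfl | ⟨hx, i, rfl⟩)
          · exact ⟨a, by simp [a]⟩
          · refine ⟨i, hrest i ?_⟩
            rintro rfl
            simp [a] at hx
      · exact Finset.mem_image.2 ⟨a, Finset.mem_univ _, by simp [a]⟩
      · simp only [Finset.mem_image, Finset.mem_univ, true_and, not_exists]
        intro i
        split_ifs with h
        · exact (hlow i h).ne
        · rcases (not_lt.1 h).eq_or_lt with h | h
          · have : i = a := Fin.ext h.symm
            rw [this]; exact hlt.ne'
          · have := hhigh i h; omega
  simpa using key k le_rfl

/-! ### Members avoiding `1` in a shifted family, and the intersecting case -/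

/-- In a shifted family with `|F₀ ∪ ⋯ ∪ Fₛ| ≤ k + s (k - 1)`, every member avoiding `1` has, for
some `j`, more than `j` elements up to `(s + 1) j + 1`. -/
theorem IsShifted.exists_card_inter_Icc {F : Finset (Finset ℕ)} (hF : IsShifted F) {n k s : ℕ}
    (hk : 0 < k) (hs : 0 < s) (hFk : F ⊆ (Finset.Icc 1 n).powersetCard k)
    (hU : HasPropertyU F (s + 1) (k + s * (k - 1))) {A : Finset ℕ} (hA : A ∈ F) (h1 : 1 ∉ A) :
    ∃ j, j + 1 ≤ (A ∩ Finset.Icc 2 ((s + 1) * j + 1)).card := by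
  by_contra! hcon
  obtain ⟨hAn, hAk⟩ := Finset.mem_powersetCard.1 (hFk hA)
  have hA2 : ∀ x ∈ A, 2 ≤ x := by
    intro x hx
    have := (Finset.mem_Icc.1 (hAn hx)).1
    rcases this.eq_or_lt with h | h
    · exact absurd (h ▸ hx) h1
    · exact h
  let f : Fin k → ℕ := A.orderEmbOfFin hAk
  have hf : StrictMono f := (A.orderEmbOfFin hAk).strictMono
  have hfA : ∀ i, f i ∈ A := fun i => A.orderEmbOfFin_mem hAk i
  have hfim : Finset.univ.image f = A := A.image_orderEmbOfFin_univ hAk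
  have hlarge : ∀ i : Fin k, (s + 1) * i.1 + 2 ≤ f i := by
    intro i
    by_contra! hlt
    have hsub : (Finset.Iic i).image f ⊆ A ∩ Finset.Icc 2 ((s + 1) * i.1 + 1) := by
      intro x hx
      obtain ⟨l, hl, rfl⟩ := Finset.mem_image.1 hx
      have := hf.monotone (Finset.mem_Iic.1 hl)
      exact Finset.mem_inter.2 ⟨hfA l, Finset.mem_Icc.2 ⟨hA2 _ (hfA l), by omega⟩⟩
    have h2 := Finset.card_le_card hsub
    rw [Finset.card_image_of_injective _ hf.injective, Fin.card_Iic] at h2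
    have := hcon i.1
    omega
  -- For `i ≥ 1` the `s + 1` values at `i` fill the block from `(s+1)(i-1) + 3` to `(s+1)i + 2`; for
  -- `i = 0` they give only `1` and `2`, the `max` correcting the truncated subtraction. The union
  -- thus has `k + s(k-1) + 1` elements, one too many.
  let g : Fin (s + 1) → Fin k → ℕ := fun l i => max 1 ((s + 1) * i.1 + 2 - l.1)
  have hgmem : ∀ l, Finset.univ.image (g l) ∈ F := by
    intro l
    refine hF.image_mem (f := f) hf ?_ ?_ (fun i => le_max_left _ _) (hfim ▸ hA)
    · intro i i' hii
      have h2 : (s + 1) * (i.1 + 1) ≤ (s + 1) * i'.1 := Nat.mul_le_mul_left _ hii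
      have h3 := l.2
      simp only [g]
      rw [mul_add] at h2
      omega
    · intro i
      have := hlarge i
      simp only [g]
      omega
  have hcover : Finset.Icc 1 ((s + 1) * (k - 1) + 2) ⊆
      Finset.univ.biUnion (fun l => Finset.univ.image (g l)) := by
    intro x hx
    obtain ⟨hx1, hx2⟩ := Finset.mem_Icc.1 hx
    simp only [Finset.mem_biUnion, Finset.mem_image, Finset.mem_univ, true_and]
    by_cases hx3 : x ≤ 2
    · rcases Nat.lt_or_ge 1 x with hx4 | hx4
      · exact ⟨0, ⟨0, hk⟩, by simp [g]; omega⟩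
      · exact ⟨⟨1, by omega⟩, ⟨0, hk⟩, by simp only [g]; omega⟩
    · have hlt : x - 3 < (s + 1) * (k - 1) := by omega
      have hdiv := Nat.div_lt_of_lt_mul hlt
      have hmod : (x - 3) % (s + 1) < s + 1 := Nat.mod_lt _ (Nat.succ_pos s)
      have hdm := Nat.div_add_mod (x - 3) (s + 1)
      refine ⟨⟨s - (x - 3) % (s + 1), by omega⟩, ⟨(x - 3) / (s + 1) + 1, by omega⟩, ?_⟩
      simp only [g, mul_add, mul_one]
      omega
  have h2 := (Finset.card_le_card hcover).trans (hU _ hgmem)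
  rw [Nat.card_Icc, add_mul, one_mul] at h2
  omega

/-- The intersecting case, transported to Mathlib's Erdős–Ko–Rado theorem. -/
theorem card_le_choose_of_intersecting {n k : ℕ} (hn : 2 * k ≤ n)
    {F : Finset (Finset ℕ)} (hF : F ⊆ (Finset.Icc 1 n).powersetCard k)
    (hint : ∀ A ∈ F, ∀ B ∈ F, ¬ Disjoint A B) : F.card ≤ (n - 1).choose (k - 1) := by
  classical
  let e : Fin n ↪ ℕ := ⟨fun x => x.1 + 1, fun a b h => Fin.ext (by simpa using h)⟩
  let φ : Finset ℕ → Finset (Fin n) := fun A => Finset.univ.filter (fun x => e x ∈ A)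
  have hφ : ∀ A ∈ F, (φ A).map e = A := by
    intro A hA
    ext y
    simp only [φ, Finset.mem_map, Finset.mem_filter, Finset.mem_univ, true_and]
    constructor
    · rintro ⟨x, hx, rfl⟩
      exact hx
    · intro hy
      have := Finset.mem_Icc.1 ((Finset.mem_powersetCard.1 (hF hA)).1 hy)
      have hy' : e ⟨y - 1, by omega⟩ = y := by
        change y - 1 + 1 = y
        omega
      exact ⟨⟨y - 1, by omega⟩, hy'.symm ▸ hy, hy'⟩
  have hcard : (F.image φ).card = F.card := by
    refine Finset.card_image_of_injOn ?_
    intro A hA B hB h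
    rw [← hφ A hA, ← hφ B hB, h]
  rw [← hcard]
  refine Finset.erdos_ko_rado ?_ ?_ (by omega)
  · intro X hX Y hY hd
    obtain ⟨A, hA, rfl⟩ := Finset.mem_image.1 (Finset.mem_coe.1 hX)
    obtain ⟨B, hB, rfl⟩ := Finset.mem_image.1 (Finset.mem_coe.1 hY)
    refine hint A hA B hB ?_
    rw [← hφ A hA, ← hφ B hB, Finset.disjoint_map]
    exact hd
  · intro X hX
    obtain ⟨A, hA, rfl⟩ := Finset.mem_image.1 (Finset.mem_coe.1 hX)
    rw [← (Finset.mem_powersetCard.1 (hF hA)).2]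
    conv_rhs => rw [← hφ A hA]
    simp

/-! ### Missing star sets and the double count -/

/-- The union of a set with pairwise disjoint sets, all disjoint from it, and a new point. -/
theorem card_biUnion_cons_insert {s k l : ℕ} (hs : 0 < s) {A : Finset ℕ} (hA : A.card = k)
    (hA1 : 1 ∉ A) {g : Fin s → Finset ℕ} (hg : ∀ i, (g i).card = l) (hg1 : ∀ i, 1 ∉ g i)
    (hgA : ∀ i, Disjoint A (g i)) (hd : Pairwise (fun i j => Disjoint (g i) (g j))) :
    k + s * l + 1 ≤ (Finset.univ.biUnion
      (Fin.cons A (fun i => insert 1 (g i)) : Fin (s + 1) → Finset ℕ)).card := by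
  have hcard : (insert 1 (A ∪ Finset.univ.biUnion g)).card = k + s * l + 1 := by
    rw [Finset.card_insert_of_notMem (by simp [hA1, hg1]), Finset.card_union_of_disjoint,
      Finset.card_biUnion (fun i _ j _ hij => hd hij), hA]
    · simp [hg]
    · rw [Finset.disjoint_biUnion_right]
      exact fun i _ => hgA i
  rw [← hcard]
  refine Finset.card_le_card ?_
  intro x hx
  simp only [Finset.mem_biUnion, Finset.mem_univ, true_and, Fin.exists_fin_succ, Fin.cons_zero,
    Fin.cons_succ, Finset.mem_insert, Finset.mem_union] at hx ⊢
  rcases hx with rfl | hx | ⟨i, hi⟩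
  · exact Or.inr ⟨⟨0, hs⟩, Or.inl rfl⟩
  · exact Or.inl hx
  · exact Or.inr ⟨i, Or.inr hi⟩

/-- Let `A` avoid `1` in a family with `|F₀ ∪ ⋯ ∪ Fₛ| ≤ k + s (k - 1)`. Then among the
`(k - 1)`-sets `G` disjoint from `A`, those with `G ∪ {1}` outside the family have density at least
`1 - (s - 1) / t`. -/
theorem mul_choose_le_card_disjoint_missing {n k s : ℕ} (hs : 0 < s)
    {F : Finset (Finset ℕ)} (hF : F ⊆ (Finset.Icc 1 n).powersetCard k)
    (hU : HasPropertyU F (s + 1) (k + s * (k - 1))) {A : Finset ℕ} (hA : A ∈ F) (h1 : 1 ∉ A)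
    (hn : (s ^ 2 + 2 * s - 1) * (k - 1) ≤ n - k - 1) :
    (s ^ 2 + s) * (n - k - 1).choose (k - 1) ≤ (s ^ 2 + 2 * s - 1) *
      (((Finset.Icc 2 n).powersetCard (k - 1)).filter
        (fun G => insert 1 G ∉ F ∧ Disjoint A G)).card := by
  obtain ⟨hAn, hAk⟩ := Finset.mem_powersetCard.1 (hF hA)
  have hA2 : A ⊆ Finset.Icc 2 n := by
    intro x hx
    have h2 := Finset.mem_Icc.1 (hAn hx)
    have h3 : x ≠ 1 := fun h => h1 (h ▸ hx)
    exact Finset.mem_Icc.2 ⟨by omega, h2.2⟩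
  have hX : (Finset.Icc 2 n \ A).card = n - k - 1 := by
    rw [Finset.card_sdiff_of_subset hA2, Nat.card_Icc, hAk]
    omega
  have hmatch := mul_card_le_of_no_matching_on (Finset.Icc 2 n \ A) (k - 1) s (s ^ 2 + 2 * s - 1)
    (((Finset.Icc 2 n \ A).powersetCard (k - 1)).filter (fun G => insert 1 G ∈ F))
    (Finset.filter_subset _ _) (by rw [hX]; exact hn) (by
      intro g hg hd
      have hg' : ∀ i, (g i ⊆ Finset.Icc 2 n \ A ∧ (g i).card = k - 1) ∧ insert 1 (g i) ∈ F :=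
        fun i => by simpa only [Finset.mem_filter, Finset.mem_powersetCard] using hg i
      have h2 := card_biUnion_cons_insert hs hAk h1 (fun i => (hg' i).1.2)
        (fun i hi => by simpa using (hg' i).1.1 hi)
        (fun i => Finset.disjoint_sdiff.mono_right (hg' i).1.1) hd
      have h3 := hU (Fin.cons A (fun i => insert 1 (g i)))
        (fun i => Fin.cases hA (fun i => (hg' i).2) i)
      omega)
  rw [hX] at hmatch
  have hsplit := Finset.card_filter_add_card_filter_not
    (s := (Finset.Icc 2 n \ A).powersetCard (k - 1)) (fun G => insert 1 G ∈ F)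
  rw [Finset.card_powersetCard, hX] at hsplit
  have hset : ((Finset.Icc 2 n \ A).powersetCard (k - 1)).filter (fun G => insert 1 G ∉ F) =
      ((Finset.Icc 2 n).powersetCard (k - 1)).filter
        (fun G => insert 1 G ∉ F ∧ Disjoint A G) := by
    ext G
    simp only [Finset.mem_filter, Finset.mem_powersetCard, Finset.subset_sdiff]
    rw [disjoint_comm]
    tauto
  rw [hset] at hsplit
  -- Hence `1 - (s - 1) / t = (s² + s) / t`.
  have ht : s ^ 2 + 2 * s - 1 = (s ^ 2 + s) + (s - 1) := by omega
  rw [← hsplit] at hmatch ⊢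
  rw [ht] at hmatch ⊢
  nlinarith

/-- A bipartite double count. -/
theorem card_le_card_of_double_count {α β : Type*} (S : Finset α) (T : Finset β)
    (r : α → β → Prop) [∀ a b, Decidable (r a b)] {c t : ℕ} (hc : 0 < c)
    (hS : ∀ a ∈ S, c ≤ t * (T.filter (fun b => r a b)).card)
    (hT : ∀ b ∈ T, t * (S.filter (fun a => r a b)).card ≤ c) : S.card ≤ T.card := by
  refine Nat.le_of_mul_le_mul_right ?_ hc
  have hcomm : ∑ a ∈ S, (T.filter (fun b => r a b)).card = ∑ b ∈ T, (S.filter (fun a => r a b)).card :=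
    Finset.sum_card_bipartiteAbove_eq_sum_card_bipartiteBelow r
  calc S.card * c = ∑ _a ∈ S, c := by simp
    _ ≤ ∑ a ∈ S, t * (T.filter (fun b => r a b)).card := Finset.sum_le_sum hS
    _ = ∑ b ∈ T, t * (S.filter (fun a => r a b)).card := by
        rw [← Finset.mul_sum, hcomm, Finset.mul_sum]
    _ ≤ ∑ _b ∈ T, c := Finset.sum_le_sum hT
    _ = T.card * c := by simp

theorem card_le_choose_of_isShifted {n k s : ℕ} (hk : 2 ≤ k) (hs : 2 ≤ s)
    (hn : s * (s + 2) * k < n) {F : Finset (Finset ℕ)}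
    (hF : F ⊆ (Finset.Icc 1 n).powersetCard k)
    (hU : HasPropertyU F (s + 1) (k + s * (k - 1))) (hsh : IsShifted F) :
    F.card ≤ (n - 1).choose (k - 1) := by
  classical
  -- Since `s(s+2) = t + 1`, room for `t` disjoint sets remains after `k` points are given up to
  -- `A`, or to `G ∪ {1}`.
  have ht : (s ^ 2 + 2 * s - 1) * k + k + 1 ≤ n := by
    have h1 : s ^ 2 + 2 * s - 1 + 1 = s * (s + 2) := by
      have : 0 < s ^ 2 + 2 * s := by positivity
      rw [Nat.sub_add_cancel this]; ring
    rw [← h1, add_mul, one_mul] at hn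
    exact hn
  have ht1 : (s ^ 2 + 2 * s - 1) * (k - 1) ≤ n - k - 1 := by
    have := Nat.mul_le_mul_left (s ^ 2 + 2 * s - 1) (Nat.sub_le k 1)
    omega
  have ht2 : k ≤ (s ^ 2 + 2 * s - 1) * k := Nat.le_mul_of_pos_left k (by
    have : 0 < s ^ 2 := by positivity
    omega)
  let S := F.filter (fun A => 1 ∉ A)
  let T := ((Finset.Icc 2 n).powersetCard (k - 1)).filter (fun G => insert 1 G ∉ F)
  have hST : S.card ≤ T.card := by
    refine card_le_card_of_double_count S T (fun A G => Disjoint A G)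
      (c := (s ^ 2 + s) * (n - k - 1).choose (k - 1)) (t := s ^ 2 + 2 * s - 1)
      (Nat.mul_pos (by positivity) (Nat.choose_pos (by omega))) ?_ ?_
    · intro A hA
      obtain ⟨hA, h1⟩ := Finset.mem_filter.1 hA
      have := mul_choose_le_card_disjoint_missing (by omega) hF hU hA h1 ht1
      simpa only [T, Finset.filter_filter] using this
    · intro G hG
      obtain ⟨hGn, hGk⟩ := Finset.mem_powersetCard.1 (Finset.mem_filter.1 hG).1
      have hY : (Finset.Icc 2 n \ G).card = n - k := by
        rw [Finset.card_sdiff_of_subset hGn, Nat.card_Icc, hGk]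
        omega
      have hb := card_ballot_violating_add_le s (Finset.Icc 2 n \ G)
        (fun y hy => (Finset.mem_Icc.1 (Finset.mem_sdiff.1 hy).1).1) (k - 1)
      rw [hY, Nat.sub_add_cancel (by omega : 1 ≤ k)] at hb
      have hnum := mul_le_of_add_choose_le s k (n - k) _ hs (by omega) (by omega) hb
      refine le_trans (Nat.mul_le_mul_left _ (Finset.card_le_card ?_)) hnum
      intro A hA
      obtain ⟨hA, hAG⟩ := Finset.mem_filter.1 hA
      obtain ⟨hA, h1⟩ := Finset.mem_filter.1 hA
      obtain ⟨hAn, hAk⟩ := Finset.mem_powersetCard.1 (hF hA)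
      refine Finset.mem_filter.2 ⟨Finset.mem_powersetCard.2 ⟨?_, hAk⟩,
        hsh.exists_card_inter_Icc (by omega) (by omega) hF hU hA h1⟩
      refine Finset.subset_sdiff.2 ⟨?_, hAG⟩
      intro x hx
      have h2 := Finset.mem_Icc.1 (hAn hx)
      have h3 : x ≠ 1 := fun h => h1 (h ▸ hx)
      exact Finset.mem_Icc.2 ⟨by omega, h2.2⟩
  have hlink : (F.filter (fun A => 1 ∈ A)).card ≤
      (((Finset.Icc 2 n).powersetCard (k - 1)).filter (fun G => insert 1 G ∈ F)).card := by
    refine Finset.card_le_card_of_injOn (fun A => A.erase 1) ?_ ?_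
    · intro A hA
      obtain ⟨hA, h1⟩ := Finset.mem_filter.1 (Finset.mem_coe.1 hA)
      obtain ⟨hAn, hAk⟩ := Finset.mem_powersetCard.1 (hF hA)
      refine Finset.mem_coe.2 (Finset.mem_filter.2 ⟨Finset.mem_powersetCard.2 ⟨?_, ?_⟩, ?_⟩)
      · intro x hx
        obtain ⟨h2, hx⟩ := Finset.mem_erase.1 hx
        have h3 := Finset.mem_Icc.1 (hAn hx)
        exact Finset.mem_Icc.2 ⟨by omega, h3.2⟩
      · rw [Finset.card_erase_of_mem h1, hAk]
      · rwa [Finset.insert_erase h1]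
    · intro A hA B hB h
      have hA1 := (Finset.mem_filter.1 (Finset.mem_coe.1 hA)).2
      have hB1 := (Finset.mem_filter.1 (Finset.mem_coe.1 hB)).2
      rw [← Finset.insert_erase hA1, ← Finset.insert_erase hB1]
      exact congrArg (insert 1) h
  have h1 := Finset.card_filter_add_card_filter_not (s := F) (fun A => 1 ∈ A)
  have h2 := Finset.card_filter_add_card_filter_not
    (s := (Finset.Icc 2 n).powersetCard (k - 1)) (fun G => insert 1 G ∈ F)
  rw [Finset.card_powersetCard, Nat.card_Icc, show n + 1 - 2 = n - 1 by omega] at h2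
  simp only [S, T] at hST
  omega

theorem mainTheorem2 (n k s : ℕ) (hn0 : 0 < n) (hk : 0 < k) (hs : 0 < s)
    (hn : s * (s + 2) * k < n)
    (F : Finset (Finset ℕ)) (hF : F ⊆ (Finset.Icc 1 n).powersetCard k)
    (hU : HasPropertyU F (s + 1) (k + s * (k - 1))) :
    F.card ≤ (n - 1).choose (k - 1) := by
  have hkn : 2 * k ≤ n := by
    have : 3 ≤ s * (s + 2) := by nlinarith
    nlinarith
  by_cases hint : ∀ A ∈ F, ∀ B ∈ F, ¬ Disjoint A B
  · exact card_le_choose_of_intersecting hkn hF hint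
  push Not at hint
  obtain ⟨A, hA, B, hB, hAB⟩ := hint
  -- One copy of `A` and `s` copies of `B` have a union of size `2k`; the resulting inequality rules
  -- out `k = 1` and `s = 1`.
  have hbig : 2 * k ≤ k + s * (k - 1) := by
    have h1 : A ∪ B ⊆ Finset.univ.biUnion (Fin.cons A (fun _ => B) : Fin (s + 1) → Finset ℕ) := by
      intro x hx
      simp only [Finset.mem_biUnion, Finset.mem_univ, true_and, Fin.exists_fin_succ,
        Fin.cons_zero, Fin.cons_succ]
      rcases Finset.mem_union.1 hx with hx | hx
      · exact Or.inl hx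
      · exact Or.inr ⟨⟨0, hs⟩, hx⟩
    have h2 := (Finset.card_le_card h1).trans
      (hU _ (fun i => Fin.cases hA (fun _ => hB) i))
    rw [Finset.card_union_of_disjoint hAB, (Finset.mem_powersetCard.1 (hF hA)).2,
      (Finset.mem_powersetCard.1 (hF hB)).2] at h2
    omega
  have hk2 : 2 ≤ k := by
    by_contra! h
    obtain rfl : k = 1 := by omega
    simp at hbig
  have hs2 : 2 ≤ s := by
    by_contra! h
    obtain rfl : s = 1 := by omega
    omega
  obtain ⟨G, hG, hGU, hGF, hsh⟩ := exists_isShifted hF hU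
  rw [← hGF]
  exact card_le_choose_of_isShifted hk2 hs2 hn hG hGU hsh
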